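/- **Weak maximum principle.** Let $d \geq 3$, let $U \subset \mathbb{R}^d$ be a bounded open set, let $\mathbf{H} \in L^d(U,\mathbb{R}^d)$, and let $A=(a_{ij})_{1\le i,j\le d}$ be a (possibly non-symmetric) matrix of measurable functions on $\mathbb{R}^d$ for which there are constants $M>0$ and $\lambda>0$ such that, for a.e. $x\in\mathbb{R}^d$, $$\max_{1\le i,j\le d}|a_{ij}(x)|\le M \quad\text{and}\quad \langle A(x)\xi,\xi\rangle\ge\lambda\|\xi\|^2 \ \text{ for all } \xi\in\mathbb{R}^d .$$ Let $H^{1,2}_0(U)$ be the closure of $C_0^\infty(U)$ in the Sobolev space $H^{1,2}(U)$, and for $f,g\in H^{1,2}_0(U)$ put $$\mathcal{B}(f,g):=\int_U\langle A\nabla f+f\mathbf{H},\nabla g\rangle\,dx ,$$ where $\nabla$ is the weak gradient. If $u\in H^{1,2}_0(U)$ satisfies $\mathcal{B}(u,\varphi)\le 0$ for all $\varphi\in H^{1,2}_0(U)$ with $\varphi\ge 0$ a.e. in $U$, then $u\le 0$ a.e. in $U$. -/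

import Mathlib

open MeasureTheory
open scoped ENNReal ContDiff InnerProductSpace

noncomputable section

namespace WeakMax

/-- Euclidean space `ℝ^d`. -/
abbrev Eucl (d : ℕ) : Type := EuclideanSpace ℝ (Fin d)

/-- `φ ∈ C₀^∞(U)`: a smooth function whose support is a compact subset of the open set `U`
(identified with its extension by zero to `ℝ^d`). -/
structure IsTestFunction {d : ℕ} (U : Set (Eucl d)) (φ : Eucl d → ℝ) : Prop where
  contDiff : ContDiff ℝ ∞ φ
  hasCompactSupport : HasCompactSupport φ
  tsupport_subset : tsupport φ ⊆ U

/-- `G` is a weak gradient of `u` on `U`: both are locally integrable on `U`, and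
`∫_U u ∂ᵢφ dx = - ∫_U Gᵢ φ dx` for every `φ ∈ C₀^∞(U)` and every index `i`. -/
structure HasWeakGrad {d : ℕ} (U : Set (Eucl d)) (u : Eucl d → ℝ) (G : Eucl d → Eucl d) :
    Prop where
  locallyIntegrableOn : LocallyIntegrableOn u U volume
  locallyIntegrableOn_grad : LocallyIntegrableOn G U volume
  integral_eq : ∀ φ : Eucl d → ℝ, IsTestFunction U φ → ∀ i : Fin d,
    ∫ x in U, u x * fderiv ℝ φ x (EuclideanSpace.single i (1 : ℝ)) = - ∫ x in U, G x i * φ x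

open Classical in
/-- The weak gradient `∇u` of `u` on `U` (zero if there is none). It is unique up to a null set of
`U`, see `HasWeakGrad.weakGrad_ae_eq`. -/
def weakGrad {d : ℕ} (U : Set (Eucl d)) (u : Eucl d → ℝ) : Eucl d → Eucl d :=
  if h : ∃ G, HasWeakGrad U u G then h.choose else 0

/-- `u ∈ H^{1,2}(U)`: `u ∈ L²(U)` has weak partial derivatives, and these belong to `L²(U)`. -/
def MemH1 {d : ℕ} (U : Set (Eucl d)) (u : Eucl d → ℝ) : Prop :=
  MemLp u 2 (volume.restrict U) ∧ ∃ G, HasWeakGrad U u G ∧ MemLp G 2 (volume.restrict U)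

/-- The `H^{1,2}(U)`-norm `(‖u‖²_{L²(U)} + ‖∇u‖²_{L²(U)})^{1/2}`. -/
def h1Norm {d : ℕ} (U : Set (Eucl d)) (u : Eucl d → ℝ) : ℝ≥0∞ :=
  (eLpNorm u 2 (volume.restrict U) ^ 2 + eLpNorm (weakGrad U u) 2 (volume.restrict U) ^ 2)
    ^ (1 / 2 : ℝ)

/-- `u ∈ H₀^{1,2}(U)`: `u` lies in the closure of `C₀^∞(U)` in `H^{1,2}(U)`. -/
def MemH10 {d : ℕ} (U : Set (Eucl d)) (u : Eucl d → ℝ) : Prop :=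
  MemH1 U u ∧ ∀ ε : ℝ≥0∞, 0 < ε → ∃ φ : Eucl d → ℝ,
    IsTestFunction U φ ∧ h1Norm U (fun x => u x - φ x) < ε

/-- The vector `A ξ`. -/
def matVec {d : ℕ} (A : Matrix (Fin d) (Fin d) ℝ) (ξ : Eucl d) : Eucl d :=
  WithLp.toLp 2 (A.mulVec ξ.ofLp)

/-- The standing assumption on `U`, `H`, `A`: `d ≥ 3`, `U` is a bounded open subset of `ℝ^d`,
`H ∈ L^d(U, ℝ^d)`, and `A` is a (possibly non-symmetric) matrix of Lebesgue measurable functions on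
`ℝ^d` that is bounded and uniformly strictly elliptic. -/
structure ConditionT1 {d : ℕ} (U : Set (Eucl d)) (H : Eucl d → Eucl d)
    (A : Eucl d → Matrix (Fin d) (Fin d) ℝ) : Prop where
  three_le : 3 ≤ d
  isOpen : IsOpen U
  isBounded : Bornology.IsBounded U
  memLp_drift : MemLp H (d : ℝ≥0∞) (volume.restrict U)
  aemeasurable_coeff : ∀ i j, AEMeasurable (fun x => A x i j) volume
  elliptic : ∃ M : ℝ, ∃ lam : ℝ, 0 < M ∧ 0 < lam ∧ ∀ᵐ x : Eucl d,
    (∀ i j, |A x i j| ≤ M) ∧ ∀ ξ : Eucl d, lam * ‖ξ‖ ^ 2 ≤ ⟪matVec (A x) ξ, ξ⟫_ℝ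

/-- The bilinear form `B(f, g) = ∫_U ⟨A ∇f + f H, ∇g⟩ dx`. -/
def bilin {d : ℕ} (U : Set (Eucl d)) (H : Eucl d → Eucl d)
    (A : Eucl d → Matrix (Fin d) (Fin d) ℝ) (f g : Eucl d → ℝ) : ℝ :=
  ∫ x in U, ⟪matVec (A x) (weakGrad U f x) + f x • H x, weakGrad U g x⟫_ℝ

theorem HasWeakGrad.ae_eq {d : ℕ} {U : Set (Eucl d)} (hU : IsOpen U) {u : Eucl d → ℝ}
    {G G' : Eucl d → Eucl d} (h : HasWeakGrad U u G) (h' : HasWeakGrad U u G') :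
    G =ᵐ[volume.restrict U] G' := by
  have comp : ∀ (F : Eucl d → Eucl d), LocallyIntegrableOn F U volume → ∀ i : Fin d,
      LocallyIntegrableOn (fun x => F x i) U volume := by
    intro F hF i x hx
    obtain ⟨s, hs, hi⟩ := hF x hx
    exact ⟨s, hs, (EuclideanSpace.proj (𝕜 := ℝ) i).integrable_comp hi⟩
  have key : ∀ i : Fin d, ∀ᵐ x, x ∈ U → G x i - G' x i = 0 := by
    intro i
    have l1 := comp G h.locallyIntegrableOn_grad i
    have l2 := comp G' h'.locallyIntegrableOn_grad i
    refine hU.ae_eq_zero_of_integral_contDiff_smul_eq_zero (l1.sub l2) ?_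
    intro φ hφ hc hs
    have ht : IsTestFunction U φ := ⟨hφ, hc, hs⟩
    have e := (h.integral_eq φ ht i).symm.trans (h'.integral_eq φ ht i)
    have int : ∀ f : Eucl d → ℝ, LocallyIntegrableOn f U volume →
        Integrable (fun x => φ x * f x) := by
      intro f hf
      have hK : IntegrableOn f (tsupport φ) := hf.integrableOn_compact_subset hs hc
      have := hK.continuousOn_mul (hφ.continuous.continuousOn) hc
      refine (integrableOn_iff_integrable_of_support_subset ?_).1 this
      intro x hx
      exact subset_tsupport φ (left_ne_zero_of_mul hx)
    have full : ∀ f : Eucl d → ℝ, ∫ x in U, f x * φ x = ∫ x, φ x * f x := by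
      intro f
      simp_rw [mul_comm (f _)]
      refine setIntegral_eq_integral_of_forall_compl_eq_zero ?_
      intro x hx
      have : φ x = 0 := by
        by_contra hne
        exact hx (hs (subset_tsupport φ hne))
      simp [this]
    rw [full, full] at e
    simp only [smul_eq_mul, mul_sub]
    rw [integral_sub (int _ l1) (int _ l2)]
    linarith
  refine (ae_restrict_iff' hU.measurableSet).2 ?_
  filter_upwards [ae_all_iff.2 key] with x hx hxU
  ext i
  exact sub_eq_zero.1 (hx i hxU)

theorem HasWeakGrad.weakGrad_ae_eq {d : ℕ} {U : Set (Eucl d)} (hU : IsOpen U) {u : Eucl d → ℝ}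
    {G : Eucl d → Eucl d} (h : HasWeakGrad U u G) :
    weakGrad U u =ᵐ[volume.restrict U] G := by
  have hex : ∃ G, HasWeakGrad U u G := ⟨G, h⟩
  have : weakGrad U u = hex.choose := dif_pos hex
  rw [this]
  exact HasWeakGrad.ae_eq hU hex.choose_spec h

end WeakMax

end

/-!
# A weak maximum principle for divergence-form operators with drift

The proof tests the inequality `B(u, φ) ≤ 0` with `φ = F(u)`, where `F' = w²` and `w ≥ 0` is a smooth
bounded function vanishing on `(-∞, 0]` with `|s w(s)| ≤ 1`, that is, a regularization of `1 / s` on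
the positive half-line. With `g = w(u) ∇u` the integrand of `B(u, F(u))` equals
`⟨A g, g⟩ + u w(u) ⟨H, g⟩ ≥ λ |g|² - |H| |g|`, whence `‖g‖₂ ≤ λ⁻¹ ‖H‖₂` independently of `w`
(`eLpNorm_smul_weakGrad_le`). As `g` is the weak gradient of `G(u)`, where `G' = w` and `G(0) = 0`, the
Poincaré inequality (`exists_poincare`) bounds `‖G(u)‖₂` by a constant independent of `w`. Since
`1 / s` is not integrable at `0`, `w` can be chosen with `G` as large as desired on `[δ, ∞)`
(`exists_smooth_regularized_inv`), so Markov's inequality shows that `{u ≥ δ}` is a null set for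
every `δ > 0`.

Because `F` and `G` are smooth, the chain rule in `H₀^{1,2}(U)` (`MemH10.comp`) follows directly by
approximation with test functions, whose compositions with `F` and `G` are again test functions.
No Sobolev embedding is needed to make the drift term integrable: `u w(u)` is bounded, and
`H ∈ L²(U)` because `U` is bounded.
-/

namespace WeakMax
open Filter Topology Gradient

variable {d : ℕ} {U : Set (Eucl d)}

/-! ### Weak gradients -/

theorem gradient_apply (φ : Eucl d → ℝ) (x : Eucl d) (i : Fin d) :
    ∇ φ x i = fderiv ℝ φ x (EuclideanSpace.single i (1 : ℝ)) := by
  have h : ⟪∇ φ x, EuclideanSpace.single i (1 : ℝ)⟫_ℝ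
      = fderiv ℝ φ x (EuclideanSpace.single i (1 : ℝ)) :=
    InnerProductSpace.toDual_symm_apply
  rw [← h, EuclideanSpace.inner_single_right]
  simp

theorem IsTestFunction.continuous_gradient {φ : Eucl d → ℝ} (h : IsTestFunction U φ) :
    Continuous (∇ φ) :=
  (InnerProductSpace.toDual ℝ (Eucl d)).symm.continuous.comp (h.contDiff.continuous_fderiv (by simp))

theorem IsTestFunction.hasCompactSupport_gradient {φ : Eucl d → ℝ} (h : IsTestFunction U φ) :
    HasCompactSupport (∇ φ) :=
  (h.hasCompactSupport.fderiv (𝕜 := ℝ)).comp_left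
    (g := (InnerProductSpace.toDual ℝ (Eucl d)).symm) (map_zero _)

theorem IsTestFunction.memLp {φ : Eucl d → ℝ} (h : IsTestFunction U φ) (p : ℝ≥0∞) :
    MemLp φ p volume :=
  h.contDiff.continuous.memLp_of_hasCompactSupport h.hasCompactSupport

theorem IsTestFunction.memLp_gradient {φ : Eucl d → ℝ} (h : IsTestFunction U φ) (p : ℝ≥0∞) :
    MemLp (∇ φ) p volume :=
  h.continuous_gradient.memLp_of_hasCompactSupport h.hasCompactSupport_gradient

theorem IsTestFunction.hasWeakGrad {φ : Eucl d → ℝ} (h : IsTestFunction U φ) :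
    HasWeakGrad U φ (∇ φ) where
  locallyIntegrableOn := h.contDiff.continuous.locallyIntegrable.locallyIntegrableOn U
  locallyIntegrableOn_grad := h.continuous_gradient.locallyIntegrable.locallyIntegrableOn U
  integral_eq := by
    intro ψ hψ i
    have hφ0 : ∀ x, x ∉ U → φ x = 0 := fun x hx => by
      by_contra hne
      exact hx (h.tsupport_subset (subset_tsupport φ hne))
    have hψ0 : ∀ x, x ∉ U → ψ x = 0 := fun x hx => by
      by_contra hne
      exact hx (hψ.tsupport_subset (subset_tsupport ψ hne))
    rw [setIntegral_eq_integral_of_forall_compl_eq_zero (fun x hx => by simp [hφ0 x hx]),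
      setIntegral_eq_integral_of_forall_compl_eq_zero (fun x hx => by simp [hψ0 x hx])]
    simp_rw [gradient_apply]
    have c1 : Continuous fun x => fderiv ℝ φ x (EuclideanSpace.single i (1 : ℝ)) :=
      (h.contDiff.continuous_fderiv (by simp)).clm_apply continuous_const
    have c2 : Continuous fun x => fderiv ℝ ψ x (EuclideanSpace.single i (1 : ℝ)) :=
      (hψ.contDiff.continuous_fderiv (by simp)).clm_apply continuous_const
    have dφ := h.contDiff.differentiable (by simp)
    have dψ := hψ.contDiff.differentiable (by simp)
    exact integral_mul_fderiv_eq_neg_fderiv_mul_of_integrable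
      ((c1.mul hψ.contDiff.continuous).integrable_of_hasCompactSupport
        hψ.hasCompactSupport.mul_left)
      ((h.contDiff.continuous.mul c2).integrable_of_hasCompactSupport
        h.hasCompactSupport.mul_right)
      ((h.contDiff.continuous.mul hψ.contDiff.continuous).integrable_of_hasCompactSupport
        h.hasCompactSupport.mul_right)
      (fun x _ => dφ x) (fun x _ => dψ x)

/-- Products of a locally integrable function on `U` with a continuous function that is compactly
supported in `U` are integrable. -/
theorem integrableOn_mul_of_tsupport_subset {f ψ : Eucl d → ℝ}
    (hf : LocallyIntegrableOn f U volume) (hψ : Continuous ψ) (hc : HasCompactSupport ψ)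
    (hs : tsupport ψ ⊆ U) : Integrable (fun x => f x * ψ x) (volume.restrict U) := by
  have hK : IntegrableOn f (tsupport ψ) := hf.integrableOn_compact_subset hs hc
  have := hK.mul_continuousOn hψ.continuousOn hc
  refine Integrable.restrict ((integrableOn_iff_integrable_of_support_subset ?_).1 this)
  intro x hx
  exact subset_tsupport ψ (right_ne_zero_of_mul hx)

theorem IsTestFunction.integrableOn_mul_fderiv {f ψ : Eucl d → ℝ}
    (hf : LocallyIntegrableOn f U volume) (hψ : IsTestFunction U ψ) (v : Eucl d) :
    Integrable (fun x => f x * fderiv ℝ ψ x v) (volume.restrict U) := by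
  refine integrableOn_mul_of_tsupport_subset hf
    ((hψ.contDiff.continuous_fderiv (by simp)).clm_apply continuous_const) ?_ ?_
  · exact (hψ.hasCompactSupport.fderiv (𝕜 := ℝ)).comp_left (g := fun L => L v) (by simp)
  · refine (closure_mono ?_).trans ((tsupport_fderiv_subset ℝ (f := ψ)).trans hψ.tsupport_subset)
    intro x hx hx'
    exact hx (by simp [hx'])

theorem locallyIntegrableOn_apply {G : Eucl d → Eucl d} (hG : LocallyIntegrableOn G U volume)
    (i : Fin d) : LocallyIntegrableOn (fun x => G x i) U volume := by
  intro x hx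
  obtain ⟨s, hs, hi⟩ := hG x hx
  exact ⟨s, hs, (EuclideanSpace.proj (𝕜 := ℝ) i).integrable_comp hi⟩

theorem HasWeakGrad.sub {u v : Eucl d → ℝ} {G K : Eucl d → Eucl d}
    (hu : HasWeakGrad U u G) (hv : HasWeakGrad U v K) :
    HasWeakGrad U (fun x => u x - v x) (fun x => G x - K x) where
  locallyIntegrableOn := hu.locallyIntegrableOn.sub hv.locallyIntegrableOn
  locallyIntegrableOn_grad := hu.locallyIntegrableOn_grad.sub hv.locallyIntegrableOn_grad
  integral_eq := by
    intro ψ hψ i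
    have hI : ∀ {f : Eucl d → ℝ}, LocallyIntegrableOn f U volume →
        Integrable (fun x => f x * ψ x) (volume.restrict U) := fun hf =>
      integrableOn_mul_of_tsupport_subset hf hψ.contDiff.continuous hψ.hasCompactSupport
        hψ.tsupport_subset
    simp only [PiLp.sub_apply, sub_mul]
    rw [integral_sub (hψ.integrableOn_mul_fderiv hu.locallyIntegrableOn _)
        (hψ.integrableOn_mul_fderiv hv.locallyIntegrableOn _),
      integral_sub (hI (locallyIntegrableOn_apply hu.locallyIntegrableOn_grad i))
        (hI (locallyIntegrableOn_apply hv.locallyIntegrableOn_grad i)),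
      hu.integral_eq ψ hψ i, hv.integral_eq ψ hψ i]
    ring

theorem locallyIntegrableOn_of_memLp {E : Type*} [NormedAddCommGroup E] {f : Eucl d → E}
    (hU : IsOpen U) (hf : MemLp f 2 (volume.restrict U)) : LocallyIntegrableOn f U volume := by
  rw [locallyIntegrableOn_iff hU.isLocallyClosed]
  intro K hKU hK
  have : IsFiniteMeasure (volume.restrict K) := ⟨by simpa using hK.measure_lt_top⟩
  exact (hf.mono_measure (Measure.restrict_mono hKU le_rfl)).integrable (by norm_num)

/-- Pairing with a fixed `L²` function is continuous along `L²`-convergent sequences. -/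
theorem tendsto_integral_mul_of_tendsto_eLpNorm {α : Type*} [MeasurableSpace α] {μ : Measure α}
    {f : ℕ → α → ℝ} {g ψ : α → ℝ} (hf : ∀ n, MemLp (f n) 2 μ) (hg : MemLp g 2 μ)
    (hψ : MemLp ψ 2 μ) (hfg : Tendsto (fun n => eLpNorm (fun x => g x - f n x) 2 μ) atTop (𝓝 0)) :
    Tendsto (fun n => ∫ x, f n x * ψ x ∂μ) atTop (𝓝 (∫ x, g x * ψ x ∂μ)) := by
  refine tendsto_integral_of_L1' _ (hg.integrable_mul hψ).aestronglyMeasurable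
    (Eventually.of_forall fun n => (hf n).integrable_mul hψ) ?_
  have hb : Tendsto (fun n => eLpNorm (fun x => g x - f n x) 2 μ * eLpNorm ψ 2 μ) atTop (𝓝 0) := by
    simpa using ENNReal.Tendsto.mul_const hfg (Or.inr hψ.eLpNorm_ne_top)
  refine tendsto_of_tendsto_of_tendsto_of_le_of_le tendsto_const_nhds hb (fun _ => zero_le) ?_
  intro n
  have h := eLpNorm_smul_le_mul_eLpNorm (p := 2) (q := 2) (r := 1)
    hψ.aestronglyMeasurable (hg.sub (hf n)).aestronglyMeasurable
  refine le_trans (le_of_eq ?_) h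
  refine (eLpNorm_sub_comm _ _ _ _).trans ?_
  congr 1
  ext x
  simp [sub_mul]

/-- The weak gradient is a closed operator on `L²(U)`. -/
theorem HasWeakGrad.of_tendsto (hU : IsOpen U) {v : ℕ → Eucl d → ℝ} {g : ℕ → Eucl d → Eucl d}
    {u : Eucl d → ℝ} {G : Eucl d → Eucl d} (hv : ∀ n, HasWeakGrad U (v n) (g n))
    (hv2 : ∀ n, MemLp (v n) 2 (volume.restrict U)) (hg2 : ∀ n, MemLp (g n) 2 (volume.restrict U))
    (hu : MemLp u 2 (volume.restrict U)) (hG : MemLp G 2 (volume.restrict U))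
    (hvu : Tendsto (fun n => eLpNorm (fun x => u x - v n x) 2 (volume.restrict U)) atTop (𝓝 0))
    (hgG : Tendsto (fun n => eLpNorm (fun x => G x - g n x) 2 (volume.restrict U)) atTop (𝓝 0)) :
    HasWeakGrad U u G where
  locallyIntegrableOn := locallyIntegrableOn_of_memLp hU hu
  locallyIntegrableOn_grad := locallyIntegrableOn_of_memLp hU hG
  integral_eq := by
    intro ψ hψ i
    have hi : ∀ {F : Eucl d → Eucl d}, MemLp F 2 (volume.restrict U) →
        MemLp (fun x => F x i) 2 (volume.restrict U) := fun hF =>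
      (EuclideanSpace.proj (𝕜 := ℝ) i).comp_memLp' hF
    have hψi : MemLp (fun x => fderiv ℝ ψ x (EuclideanSpace.single i (1 : ℝ))) 2
        (volume.restrict U) := by
      simpa only [gradient_apply] using hi ((hψ.memLp_gradient 2).restrict U)
    have h1 := tendsto_integral_mul_of_tendsto_eLpNorm hv2 hu hψi hvu
    have h2 := tendsto_integral_mul_of_tendsto_eLpNorm (fun n => hi (hg2 n)) (hi hG)
      ((hψ.memLp 2).restrict U) (tendsto_of_tendsto_of_tendsto_of_le_of_le tendsto_const_nhds hgG
        (fun _ => zero_le) fun n => eLpNorm_mono fun x => by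
          simpa using PiLp.norm_apply_le (G x - g n x) i)
    refine tendsto_nhds_unique h1 (h2.neg.congr fun n => ?_)
    exact ((hv n).integral_eq ψ hψ i).symm

/-! ### Approximation by test functions -/

theorem MemH1.hasWeakGrad_weakGrad {u : Eucl d → ℝ} (hu : MemH1 U u) :
    HasWeakGrad U u (weakGrad U u) := by
  have hex : ∃ G, HasWeakGrad U u G := ⟨_, hu.2.choose_spec.1⟩
  rw [weakGrad, dif_pos hex]
  exact hex.choose_spec

theorem MemH1.memLp_weakGrad (hU : IsOpen U) {u : Eucl d → ℝ} (hu : MemH1 U u) :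
    MemLp (weakGrad U u) 2 (volume.restrict U) := by
  obtain ⟨-, G, hG, hG2⟩ := hu
  exact hG2.ae_eq (hG.weakGrad_ae_eq hU).symm

theorem h1Norm_eq_of_hasWeakGrad (hU : IsOpen U) {u : Eucl d → ℝ} {G : Eucl d → Eucl d}
    (h : HasWeakGrad U u G) :
    h1Norm U u = (eLpNorm u 2 (volume.restrict U) ^ 2 + eLpNorm G 2 (volume.restrict U) ^ 2)
      ^ (1 / 2 : ℝ) := by
  rw [h1Norm, eLpNorm_congr_ae (h.weakGrad_ae_eq hU)]

theorem le_rpow_half_add {a b c : ℝ≥0∞} (h : a ^ 2 ≤ b + c) : a ≤ (b + c) ^ (1 / 2 : ℝ) := by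
  calc a = (a ^ 2) ^ (1 / 2 : ℝ) := by
        rw [← ENNReal.rpow_natCast, ← ENNReal.rpow_mul]; norm_num
    _ ≤ _ := by gcongr

/-- Elements of `H₀^{1,2}(U)` are limits of sequences of test functions. -/
theorem MemH10.exists_seq (hU : IsOpen U) {u : Eucl d → ℝ} (hu : MemH10 U u) :
    ∃ φ : ℕ → Eucl d → ℝ, (∀ n, IsTestFunction U (φ n)) ∧
      Tendsto (fun n => eLpNorm (fun x => u x - φ n x) 2 (volume.restrict U)) atTop (𝓝 0) ∧
      Tendsto (fun n => eLpNorm (fun x => weakGrad U u x - ∇ (φ n) x) 2 (volume.restrict U))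
        atTop (𝓝 0) := by
  have hpos : ∀ n : ℕ, (0 : ℝ≥0∞) < ((n : ℝ≥0∞))⁻¹ := fun n => by simp
  choose φ hφ hlt using fun n : ℕ => hu.2 _ (hpos n)
  have heq : ∀ n, h1Norm U (fun x => u x - φ n x) = _ := fun n =>
    h1Norm_eq_of_hasWeakGrad hU (hu.1.hasWeakGrad_weakGrad.sub (hφ n).hasWeakGrad)
  refine ⟨φ, hφ, ?_, ?_⟩ <;>
    refine tendsto_of_tendsto_of_tendsto_of_le_of_le tendsto_const_nhds
      ENNReal.tendsto_inv_nat_nhds_zero (fun _ => zero_le) fun n => le_trans ?_ (hlt n).le <;>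
    rw [heq]
  · exact le_rpow_half_add le_self_add
  · exact le_rpow_half_add le_add_self

/-- Limits in `L²(U)`, together with their gradients, of test functions belong to
`H₀^{1,2}(U)`. -/
theorem memH10_of_tendsto (hU : IsOpen U) {u : Eucl d → ℝ} {G : Eucl d → Eucl d}
    (hu : MemLp u 2 (volume.restrict U)) (hG : MemLp G 2 (volume.restrict U))
    {φ : ℕ → Eucl d → ℝ} (hφ : ∀ n, IsTestFunction U (φ n))
    (h1 : Tendsto (fun n => eLpNorm (fun x => u x - φ n x) 2 (volume.restrict U)) atTop (𝓝 0))
    (h2 : Tendsto (fun n => eLpNorm (fun x => G x - ∇ (φ n) x) 2 (volume.restrict U))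
        atTop (𝓝 0)) :
    MemH10 U u ∧ HasWeakGrad U u G := by
  have hw : HasWeakGrad U u G := HasWeakGrad.of_tendsto hU (fun n => (hφ n).hasWeakGrad)
    (fun n => ((hφ n).memLp 2).restrict U) (fun n => ((hφ n).memLp_gradient 2).restrict U)
    hu hG h1 h2
  refine ⟨⟨⟨hu, G, hw, hG⟩, fun ε hε => ?_⟩, hw⟩
  have hlim : Tendsto (fun n => h1Norm U (fun x => u x - φ n x)) atTop (𝓝 0) := by
    simp_rw [fun n => h1Norm_eq_of_hasWeakGrad hU (hw.sub (hφ n).hasWeakGrad)]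
    have := ((ENNReal.continuous_pow 2).tendsto 0).comp h1 |>.add
      (((ENNReal.continuous_pow 2).tendsto 0).comp h2)
    simpa [Function.comp_def] using
      ((ENNReal.continuous_rpow_const (y := (1 / 2 : ℝ))).tendsto _).comp this
  obtain ⟨n, hn⟩ := (hlim.eventually (gt_mem_nhds hε)).exists
  exact ⟨φ n, hφ n, hn⟩

/-! ### The Poincaré inequality -/

/-- **Poincaré inequality** on a bounded open set. For test functions it is the
Gagliardo–Nirenberg–Sobolev inequality with exponents `2, 2`, which requires `2 < d`. -/
theorem exists_poincare (hd : 3 ≤ d) (hU : IsOpen U) (hb : Bornology.IsBounded U) :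
    ∃ C : NNReal, ∀ v : Eucl d → ℝ, MemH10 U v →
      eLpNorm v 2 (volume.restrict U) ≤ C * eLpNorm (weakGrad U v) 2 (volume.restrict U) := by
  let C : NNReal := eLpNormLESNormFDerivOfLeConst ℝ (volume : Measure (Eucl d)) U 2 2
  have htest : ∀ φ : Eucl d → ℝ, IsTestFunction U φ →
      eLpNorm φ 2 (volume.restrict U) ≤ C * eLpNorm (∇ φ) 2 (volume.restrict U) := by
    intro φ hφ
    have h := eLpNorm_le_eLpNorm_fderiv (volume : Measure (Eucl d)) (u := φ) (s := U) (p := 2)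
      (hφ.contDiff.of_le (by simp)) ((subset_tsupport φ).trans hφ.tsupport_subset)
      (by norm_num) (by
        rw [finrank_euclideanSpace_fin]
        exact_mod_cast (show 2 < d by omega)) hb
    have e : eLpNorm (∇ φ) 2 (volume.restrict U) = eLpNorm (fderiv ℝ φ) 2 volume := by
      rw [eLpNorm_restrict_eq_of_support_subset]
      · refine eLpNorm_congr_norm_ae (Eventually.of_forall fun x => ?_)
        simp [gradient]
      · intro x hx
        refine hφ.tsupport_subset (support_fderiv_subset ℝ (f := φ) ?_)
        intro h0
        exact hx (by simp [gradient, h0])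
    rw [e]
    exact (eLpNorm_mono_measure _ Measure.restrict_le_self).trans (by exact_mod_cast h)
  refine ⟨C, fun v hv => ?_⟩
  obtain ⟨φ, hφ, h1, h2⟩ := hv.exists_seq hU
  have hV := hv.1.memLp_weakGrad hU
  have hlim : Tendsto (fun n => eLpNorm (fun x => v x - φ n x) 2 (volume.restrict U) +
      C * (eLpNorm (fun x => weakGrad U v x - ∇ (φ n) x) 2 (volume.restrict U) +
        eLpNorm (weakGrad U v) 2 (volume.restrict U))) atTop
      (𝓝 (0 + C * (0 + eLpNorm (weakGrad U v) 2 (volume.restrict U)))) :=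
    h1.add (ENNReal.Tendsto.const_mul (h2.add tendsto_const_nhds) (Or.inr ENNReal.coe_ne_top))
  rw [zero_add, zero_add] at hlim
  refine ge_of_tendsto' hlim fun n => ?_
  have m1 := ((hφ n).memLp 2).restrict U
  have m2 := ((hφ n).memLp_gradient 2).restrict U
  calc eLpNorm v 2 (volume.restrict U)
      = eLpNorm ((fun x => v x - φ n x) + φ n) 2 (volume.restrict U) := by
        congr 1; ext x; simp
    _ ≤ _ + eLpNorm (φ n) 2 (volume.restrict U) :=
        eLpNorm_add_le (hv.1.1.sub m1).aestronglyMeasurable m1.aestronglyMeasurable (by norm_num)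
    _ ≤ _ := by
        gcongr
        refine (htest _ (hφ n)).trans ?_
        gcongr
        calc eLpNorm (∇ (φ n)) 2 (volume.restrict U)
            = eLpNorm (weakGrad U v - fun x => weakGrad U v x - ∇ (φ n) x) 2
              (volume.restrict U) := by congr 1; ext1 x; simp
          _ ≤ _ := eLpNorm_sub_le hV.aestronglyMeasurable (hV.sub m2).aestronglyMeasurable
                (by norm_num)
          _ = _ := add_comm _ _

/-! ### Smooth regularizations of the reciprocal -/

theorem hasDerivAt_primitive {w : ℝ → ℝ} (hw : Continuous w) (s : ℝ) :
    HasDerivAt (fun s => ∫ t in (0 : ℝ)..s, w t) (w s) s :=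
  intervalIntegral.integral_hasDerivAt_right (hw.intervalIntegrable _ _)
    (hw.stronglyMeasurableAtFilter _ _) hw.continuousAt

theorem contDiff_primitive {w : ℝ → ℝ} (hw : ContDiff ℝ ∞ w) :
    ContDiff ℝ ∞ (fun s => ∫ t in (0 : ℝ)..s, w t) := by
  rw [contDiff_infty_iff_deriv]
  refine ⟨fun s => (hasDerivAt_primitive hw.continuous s).differentiableAt, ?_⟩
  rwa [funext fun s => (hasDerivAt_primitive hw.continuous s).deriv]

theorem primitive_nonneg {w : ℝ → ℝ} (h0 : ∀ s, 0 ≤ w s) (hneg : ∀ s ≤ 0, w s = 0) (s : ℝ) :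
    0 ≤ ∫ t in (0 : ℝ)..s, w t := by
  rcases le_total 0 s with hs | hs
  · exact intervalIntegral.integral_nonneg hs fun t _ => h0 t
  · rw [intervalIntegral.integral_congr (g := fun _ => (0 : ℝ))]
    · simp
    · intro t ht
      rw [Set.uIcc_of_ge hs] at ht
      exact hneg t ht.2

/-- Smooth bounded regularizations `w` of a multiple of `1 / s` on the positive half-line. The
constraint `|s * w s| ≤ 1` still allows the primitive of `w` to be arbitrarily large beyond any given
`δ > 0`, because `1 / s` is not integrable at `0`. -/
theorem exists_smooth_regularized_inv {δ : ℝ} (hδ : 0 < δ) {R : ℝ} (hR : 0 ≤ R) :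
    ∃ w : ℝ → ℝ, ContDiff ℝ ∞ w ∧ (∀ s, 0 ≤ w s) ∧ (∀ s ≤ 0, w s = 0) ∧ (∃ K, ∀ s, w s ≤ K) ∧
      (∀ s, |s * w s| ≤ 1) ∧ ∀ s, δ ≤ s → R ≤ ∫ t in (0 : ℝ)..s, w t := by
  -- `∫_η^δ dt / (2 t) = R`
  obtain ⟨η, hη, hηδ, hlog⟩ : ∃ η : ℝ, 0 < η ∧ η ≤ δ ∧ Real.log (δ / η) = 2 * R := by
    refine ⟨δ * Real.exp (-(2 * R)), by positivity, ?_, ?_⟩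
    · exact mul_le_of_le_one_right hδ.le (Real.exp_le_one_iff.2 (by linarith))
    · rw [div_mul_eq_div_div, div_self hδ.ne', one_div, ← Real.exp_neg, neg_neg, Real.log_exp]
  have hden : ∀ s : ℝ, 0 < η ^ 2 + s ^ 2 := fun s => by positivity
  let w : ℝ → ℝ := fun s => Real.smoothTransition (s / η) * (s / (η ^ 2 + s ^ 2))
  have hw : ContDiff ℝ ∞ w := by
    refine ContDiff.mul (Real.smoothTransition.contDiff.comp (contDiff_id.div_const η)) ?_
    exact contDiff_id.div (by fun_prop) fun s => (hden s).ne'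
  have hneg : ∀ s ≤ 0, w s = 0 := fun s hs => by
    have : Real.smoothTransition (s / η) = 0 :=
      Real.smoothTransition.zero_of_nonpos (div_nonpos_of_nonpos_of_nonneg hs hη.le)
    simp [w, this]
  have h0 : ∀ s, 0 ≤ w s := fun s => by
    rcases le_total s 0 with hs | hs
    · rw [hneg s hs]
    · exact mul_nonneg (Real.smoothTransition.nonneg _) (div_nonneg hs (hden s).le)
  have hle : ∀ s, 0 ≤ s → w s ≤ s / (η ^ 2 + s ^ 2) := fun s hs =>
    mul_le_of_le_one_left (div_nonneg hs (hden s).le) (Real.smoothTransition.le_one _)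
  refine ⟨w, hw, h0, hneg, ⟨1 / (2 * η), fun s => ?_⟩, fun s => ?_, fun s hs => ?_⟩
  · rcases le_total s 0 with hs | hs
    · rw [hneg s hs]; positivity
    · refine (hle s hs).trans ?_
      rw [div_le_div_iff₀ (hden s) (by positivity)]
      nlinarith [sq_nonneg (s - η)]
  · rcases le_total s 0 with hs | hs
    · simp [hneg s hs]
    · rw [abs_of_nonneg (mul_nonneg hs (h0 s))]
      refine (mul_le_mul_of_nonneg_left (hle s hs) hs).trans ?_
      rw [← mul_div_assoc, div_le_one (hden s)]
      nlinarith [sq_nonneg η]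
  · have hint : ∀ a b, IntervalIntegrable w volume a b := fun a b =>
      hw.continuous.intervalIntegrable a b
    have hmono : ∫ t in η..δ, 2⁻¹ * (1 / t) ≤ ∫ t in η..δ, w t := by
      refine intervalIntegral.integral_mono_on hηδ ?_ (hint _ _) fun t ht => ?_
      · refine ContinuousOn.intervalIntegrable_of_Icc hηδ fun t ht => ?_
        have : t ≠ 0 := (hη.trans_le ht.1).ne'
        exact ContinuousAt.continuousWithinAt (by fun_prop (disch := assumption))
      · have ht0 : 0 < t := hη.trans_le ht.1
        have : Real.smoothTransition (t / η) = 1 :=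
          Real.smoothTransition.one_of_one_le ((one_le_div hη).2 ht.1)
        simp only [w, this, one_mul]
        rw [← div_eq_inv_mul, div_div, div_le_div_iff₀ (by positivity) (hden t)]
        nlinarith [mul_self_le_mul_self hη.le ht.1]
    rw [intervalIntegral.integral_const_mul, integral_one_div_of_pos hη hδ, hlog] at hmono
    have e1 := intervalIntegral.integral_add_adjacent_intervals (hint 0 η) (hint η δ)
    have e2 := intervalIntegral.integral_add_adjacent_intervals (hint 0 δ) (hint δ s)
    have n1 := intervalIntegral.integral_nonneg (μ := volume) hη.le fun t _ => h0 t
    have n2 := intervalIntegral.integral_nonneg (μ := volume) hs fun t _ => h0 t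
    linarith

/-! ### The chain rule -/

/-- Dominated convergence in `L²`. -/
theorem tendsto_eLpNorm_two_zero_of_dominated {α E : Type*} [MeasurableSpace α]
    {μ : Measure α} [NormedAddCommGroup E] {f : ℕ → α → E} {b : α → ℝ}
    (hf : ∀ n, AEStronglyMeasurable (f n) μ) (hb : MemLp b 2 μ)
    (hfb : ∀ n, ∀ᵐ x ∂μ, ‖f n x‖ ≤ b x)
    (hlim : ∀ᵐ x ∂μ, Tendsto (fun n => f n x) atTop (𝓝 0)) :
    Tendsto (fun n => eLpNorm (f n) 2 μ) atTop (𝓝 0) := by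
  simp_rw [eLpNorm_eq_lintegral_rpow_enorm_toReal (p := 2) two_ne_zero ENNReal.ofNat_ne_top]
  have key : Tendsto (fun n => ∫⁻ x, ‖f n x‖ₑ ^ (2 : ℝ≥0∞).toReal ∂μ) atTop
      (𝓝 (∫⁻ _, 0 ∂μ)) := by
    refine tendsto_lintegral_of_dominated_convergence' (fun x => ‖b x‖ₑ ^ (2 : ℝ≥0∞).toReal)
      (fun n => (hf n).enorm.pow_const _) (fun n => ?_) ?_ ?_
    · filter_upwards [hfb n] with x hx
      gcongr
      exact enorm_le_iff_norm_le.2 (hx.trans (le_abs_self _))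
    · exact (lintegral_rpow_enorm_lt_top_of_eLpNorm_lt_top two_ne_zero ENNReal.ofNat_ne_top
        hb.2).ne
    · filter_upwards [hlim] with x hx
      have h := ((ENNReal.continuous_rpow_const (y := (2 : ℝ≥0∞).toReal)).tendsto _).comp hx.enorm
      simpa [Function.comp_def] using h
  rw [lintegral_zero] at key
  have h := ((ENNReal.continuous_rpow_const (y := 1 / (2 : ℝ≥0∞).toReal)).tendsto _).comp key
  simpa [Function.comp_def] using h

theorem IsTestFunction.comp {φ : Eucl d → ℝ} (h : IsTestFunction U φ) {Φ : ℝ → ℝ}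
    (hΦ : ContDiff ℝ ∞ Φ) (h0 : Φ 0 = 0) : IsTestFunction U (fun x => Φ (φ x)) where
  contDiff := hΦ.comp h.contDiff
  hasCompactSupport := h.hasCompactSupport.comp_left h0
  tsupport_subset := by
    refine (closure_mono ?_).trans h.tsupport_subset
    intro x hx hx'
    exact hx (by simp [hx', h0])

theorem gradient_comp {φ : Eucl d → ℝ} {Φ : ℝ → ℝ} (hΦ : Differentiable ℝ Φ)
    (hφ : Differentiable ℝ φ) (x : Eucl d) :
    ∇ (fun y => Φ (φ y)) x = deriv Φ (φ x) • ∇ φ x := by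
  have h : HasFDerivAt (fun y => Φ (φ y)) (deriv Φ (φ x) • fderiv ℝ φ x) x :=
    (hΦ (φ x)).hasDerivAt.comp_hasFDerivAt x (hφ x).hasFDerivAt
  rw [gradient, h.fderiv, map_smul]
  rfl

/-- Chain rule in `H₀^{1,2}(U)`. Since `Φ` is smooth and `Φ 0 = 0`, composition with `Φ` maps test
functions to test functions, and the gradients converge along an a.e. convergent subsequence. -/
theorem MemH10.comp (hU : IsOpen U) {u : Eucl d → ℝ} (hu : MemH10 U u) {Φ : ℝ → ℝ}
    (hΦ : ContDiff ℝ ∞ Φ) (h0 : Φ 0 = 0) {K : ℝ} (hK : ∀ t, |deriv Φ t| ≤ K) :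
    MemH10 U (fun x => Φ (u x)) ∧
      HasWeakGrad U (fun x => Φ (u x)) (fun x => deriv Φ (u x) • weakGrad U u x) := by
  have hd : Differentiable ℝ Φ := hΦ.differentiable (by simp)
  have hc : Continuous (deriv Φ) := hΦ.continuous_deriv (by simp)
  have hK0 : 0 ≤ K := (abs_nonneg _).trans (hK 0)
  have hlip : ∀ a b, ‖Φ a - Φ b‖ ≤ K * ‖a - b‖ := fun a b =>
    convex_univ.norm_image_sub_le_of_norm_deriv_le (fun t _ => hd t) (fun t _ => hK t)
      (Set.mem_univ b) (Set.mem_univ a)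
  have hV := hu.1.memLp_weakGrad hU
  obtain ⟨φ, hφ, h1, h2⟩ := hu.exists_seq hU
  have hφm : ∀ n, AEStronglyMeasurable (φ n) (volume.restrict U) := fun n =>
    (hφ n).contDiff.continuous.aestronglyMeasurable
  obtain ⟨ns, hns, hae⟩ := (tendstoInMeasure_of_tendsto_eLpNorm (p := 2) two_ne_zero hφm
    hu.1.1.aestronglyMeasurable (h1.congr fun n => eLpNorm_sub_comm _ _ _ _)).exists_seq_tendsto_ae
  replace h1 := h1.comp hns.tendsto_atTop
  replace h2 := h2.comp hns.tendsto_atTop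
  have hmd : AEStronglyMeasurable (fun x => deriv Φ (u x)) (volume.restrict U) :=
    hc.comp_aestronglyMeasurable hu.1.1.aestronglyMeasurable
  have hmn : ∀ n, AEStronglyMeasurable (fun x => deriv Φ (φ (ns n) x)) (volume.restrict U) :=
    fun n => hc.comp_aestronglyMeasurable (hφm _)
  have hgn : ∀ n, AEStronglyMeasurable (∇ (φ (ns n))) (volume.restrict U) := fun n =>
    (hφ _).continuous_gradient.aestronglyMeasurable
  have hKlim : ∀ {e : ℕ → ℝ≥0∞}, Tendsto e atTop (𝓝 0) →
      Tendsto (fun n => ENNReal.ofReal K * e n) atTop (𝓝 0) := fun h => by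
    simpa using ENNReal.Tendsto.const_mul h (Or.inr ENNReal.ofReal_ne_top)
  refine memH10_of_tendsto hU (φ := fun n x => Φ (φ (ns n) x)) ?_ ?_
    (fun n => (hφ _).comp hΦ h0) ?_ ?_
  · refine hu.1.1.of_le_mul (c := K)
      (hΦ.continuous.comp_aestronglyMeasurable hu.1.1.aestronglyMeasurable)
      (Eventually.of_forall fun x => ?_)
    simpa [h0] using hlip (u x) 0
  · refine hV.of_le_mul (c := K) (hmd.smul hV.aestronglyMeasurable)
      (Eventually.of_forall fun x => ?_)
    rw [norm_smul]
    exact mul_le_mul_of_nonneg_right (hK _) (norm_nonneg _)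
  · refine tendsto_of_tendsto_of_tendsto_of_le_of_le tendsto_const_nhds (hKlim h1)
      (fun _ => zero_le) fun n => ?_
    exact eLpNorm_le_mul_eLpNorm_of_ae_le_mul (Eventually.of_forall fun x => hlip _ _) 2
  · -- `Φ'(u) ∇u - Φ'(φₙ) ∇φₙ = (Φ'(u) - Φ'(φₙ)) ∇u + Φ'(φₙ) (∇u - ∇φₙ)`
    have hdom : Tendsto (fun n => eLpNorm (fun x => (deriv Φ (u x) - deriv Φ (φ (ns n) x)) •
        weakGrad U u x) 2 (volume.restrict U)) atTop (𝓝 0) := by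
      refine tendsto_eLpNorm_two_zero_of_dominated (b := fun x => 2 * K * ‖weakGrad U u x‖)
        (fun n => (hmd.sub (hmn n)).smul hV.aestronglyMeasurable) (hV.norm.const_mul _)
        (fun n => Eventually.of_forall fun x => ?_) ?_
      · rw [norm_smul]
        refine mul_le_mul_of_nonneg_right ((norm_sub_le _ _).trans ?_) (norm_nonneg _)
        linarith [hK (u x), hK (φ (ns n) x), Real.norm_eq_abs (deriv Φ (u x)),
          Real.norm_eq_abs (deriv Φ (φ (ns n) x))]
      · filter_upwards [hae] with x hx
        have h3 : Tendsto (fun n => deriv Φ (u x) - deriv Φ (φ (ns n) x)) atTop (𝓝 0) := by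
          simpa using (tendsto_const_nhds (x := deriv Φ (u x))).sub ((hc.tendsto (u x)).comp hx)
        simpa using h3.smul_const (weakGrad U u x)
    have hsum := hdom.add (hKlim h2)
    rw [zero_add] at hsum
    refine tendsto_of_tendsto_of_tendsto_of_le_of_le tendsto_const_nhds hsum
      (fun _ => zero_le) fun n => ?_
    calc eLpNorm (fun x => deriv Φ (u x) • weakGrad U u x - ∇ (fun y => Φ (φ (ns n) y)) x) 2
          (volume.restrict U)
        = eLpNorm ((fun x => (deriv Φ (u x) - deriv Φ (φ (ns n) x)) • weakGrad U u x) +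
            fun x => deriv Φ (φ (ns n) x) • (weakGrad U u x - ∇ (φ (ns n)) x)) 2
            (volume.restrict U) := by
          congr 1
          ext1 x
          rw [gradient_comp hd ((hφ _).contDiff.differentiable (by simp)), Pi.add_apply, sub_smul,
            smul_sub]
          abel
      _ ≤ _ := eLpNorm_add_le ((hmd.sub (hmn n)).smul hV.aestronglyMeasurable)
          ((hmn n).smul (hV.aestronglyMeasurable.sub (hgn n))) (by norm_num)
      _ ≤ _ := by
          gcongr
          refine eLpNorm_le_mul_eLpNorm_of_ae_le_mul (Eventually.of_forall fun x => ?_) 2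
          rw [norm_smul]
          exact mul_le_mul_of_nonneg_right (hK _) (norm_nonneg _)

/-! ### The energy estimate -/

theorem matVec_smul (A : Matrix (Fin d) (Fin d) ℝ) (c : ℝ) (ξ : Eucl d) :
    matVec A (c • ξ) = c • matVec A ξ := by
  simp [matVec, Matrix.mulVec_smul]

theorem inner_matVec (A : Matrix (Fin d) (Fin d) ℝ) (ξ η : Eucl d) :
    ⟪matVec A ξ, η⟫_ℝ = ∑ i, ∑ j, A i j * (ξ j * η i) := by
  simp only [matVec, PiLp.inner_apply, Matrix.mulVec, dotProduct, RCLike.inner_apply, conj_trivial]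
  refine Finset.sum_congr rfl fun i _ => ?_
  rw [Finset.mul_sum]
  exact Finset.sum_congr rfl fun j _ => by ring

theorem integrable_inner_of_memLp {α : Type*} [MeasurableSpace α] {μ : Measure α}
    {f g : α → Eucl d} (hf : MemLp f 2 μ) (hg : MemLp g 2 μ) :
    Integrable (fun x => ⟪f x, g x⟫_ℝ) μ := by
  refine (hf.norm.integrable_mul hg.norm).mono'
    (hf.aestronglyMeasurable.inner hg.aestronglyMeasurable) (Eventually.of_forall fun x => ?_)
  exact norm_inner_le_norm _ _

/-- Caccioppoli-type estimate for subsolutions: testing with the primitive of `w ^ 2` composed with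
`u` bounds `w(u) ∇u` in `L²`, uniformly over all `w` with `|s w(s)| ≤ 1`. That constraint turns the
drift term `w(u)² u ⟨H, ∇u⟩` into a bounded multiple of `⟨H, w(u) ∇u⟩`, so that only the `L²` norm of
`H` enters. The bound `K` on `w` makes the test function admissible and does not enter either. -/
theorem eLpNorm_smul_weakGrad_le {H : Eucl d → Eucl d} {A : Eucl d → Matrix (Fin d) (Fin d) ℝ}
    (hU : IsOpen U) (hH : MemLp H 2 (volume.restrict U))
    (hA : ∀ i j, AEMeasurable (fun x => A x i j) volume) {M lam : ℝ} (hlam : 0 < lam)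
    (hell : ∀ᵐ x : Eucl d, (∀ i j, |A x i j| ≤ M) ∧
      ∀ ξ : Eucl d, lam * ‖ξ‖ ^ 2 ≤ ⟪matVec (A x) ξ, ξ⟫_ℝ)
    {u : Eucl d → ℝ} (hu : MemH10 U u)
    (hB : ∀ φ : Eucl d → ℝ, MemH10 U φ →
      (∀ᵐ x ∂(volume.restrict U), 0 ≤ φ x) → bilin U H A u φ ≤ 0)
    {w : ℝ → ℝ} (hw : ContDiff ℝ ∞ w) (hw0 : ∀ s, 0 ≤ w s) (hneg : ∀ s ≤ 0, w s = 0)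
    {K : ℝ} (hK : ∀ s, w s ≤ K) (hsw : ∀ s, |s * w s| ≤ 1) :
    eLpNorm (fun x => w (u x) • weakGrad U u x) 2 (volume.restrict U) ≤
      ENNReal.ofReal lam⁻¹ * eLpNorm H 2 (volume.restrict U) := by
  set μ := volume.restrict U with hμ
  set V := weakGrad U u with hVdef
  have hV : MemLp V 2 μ := hu.1.memLp_weakGrad hU
  have hum : AEStronglyMeasurable u μ := hu.1.1.aestronglyMeasurable
  have hwu : AEStronglyMeasurable (fun x => w (u x)) μ := hw.continuous.comp_aestronglyMeasurable hum
  set g : Eucl d → Eucl d := fun x => w (u x) • V x with hg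
  have hg2 : MemLp g 2 μ := by
    refine hV.of_le_mul (c := K) (hwu.smul hV.aestronglyMeasurable)
      (Eventually.of_forall fun x => ?_)
    rw [hg, norm_smul, Real.norm_of_nonneg (hw0 _)]
    exact mul_le_mul_of_nonneg_right (hK _) (norm_nonneg _)
  -- the test function is the primitive of `w ^ 2` composed with `u`
  have hw2 : ContDiff ℝ ∞ (fun s => w s ^ 2) := hw.pow 2
  have hderiv : deriv (fun s => ∫ t in (0 : ℝ)..s, w t ^ 2) = fun s => w s ^ 2 :=
    funext fun s => (hasDerivAt_primitive hw2.continuous s).deriv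
  obtain ⟨hF, hFG⟩ := hu.comp hU (contDiff_primitive hw2) (by simp) (K := K ^ 2) (fun t => by
    rw [hderiv, abs_of_nonneg (sq_nonneg _)]
    exact pow_le_pow_left₀ (hw0 t) (hK t) 2)
  have hBF := hB _ hF (Eventually.of_forall fun x =>
    primitive_nonneg (fun s => sq_nonneg (w s)) (fun s hs => by simp [hneg s hs]) (u x))
  have hell' := ae_restrict_of_ae (s := U) hell
  rw [← hμ] at hell'
  have hintegrand : (fun x => ⟪matVec (A x) (V x) + u x • H x,
      weakGrad U (fun x => ∫ t in (0 : ℝ)..(u x), w t ^ 2) x⟫_ℝ) =ᵐ[μ]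
      fun x => ⟪matVec (A x) (g x), g x⟫_ℝ + u x * w (u x) * ⟪H x, g x⟫_ℝ := by
    filter_upwards [hFG.weakGrad_ae_eq hU] with x hx
    rw [hx, hderiv, hg, matVec_smul]
    simp only [inner_add_left, inner_smul_left, inner_smul_right, conj_trivial]
    ring
  have hi : ∀ i, MemLp (fun x => g x i) 2 μ := fun i =>
    (EuclideanSpace.proj (𝕜 := ℝ) i).comp_memLp' hg2
  have int1 : Integrable (fun x => ⟪matVec (A x) (g x), g x⟫_ℝ) μ := by
    simp_rw [inner_matVec]
    refine integrable_finsetSum _ fun i _ => integrable_finsetSum _ fun j _ => ?_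
    refine ((hi j).integrable_mul (hi i)).bdd_mul (c := M)
      (hA i j).restrict.aestronglyMeasurable ?_
    filter_upwards [hell'] with x hx using hx.1 i j
  have int2 : Integrable (fun x => u x * w (u x) * ⟪H x, g x⟫_ℝ) μ :=
    (integrable_inner_of_memLp hH hg2).bdd_mul (c := 1) (hum.mul hwu)
      (Eventually.of_forall fun x => hsw _)
  have hgsq : Integrable (fun x => ‖g x‖ ^ 2) μ := hg2.integrable_norm_pow two_ne_zero
  have hHsq : Integrable (fun x => ‖H x‖ ^ 2) μ := hH.integrable_norm_pow two_ne_zero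
  have hint : ∫ x, (lam / 2 * ‖g x‖ ^ 2 - (2 * lam)⁻¹ * ‖H x‖ ^ 2) ∂μ ≤ 0 := by
    refine le_trans ?_ hBF
    rw [bilin, integral_congr_ae hintegrand]
    refine integral_mono_ae ((hgsq.const_mul _).sub (hHsq.const_mul _)) (int1.add int2) ?_
    filter_upwards [hell'] with x hx
    have e1 := hx.2 (g x)
    have e2 : -(‖H x‖ * ‖g x‖) ≤ u x * w (u x) * ⟪H x, g x⟫_ℝ := by
      refine (abs_le.1 ?_).1
      rw [abs_mul]
      exact (mul_le_of_le_one_left (abs_nonneg _) (hsw _)).trans (abs_real_inner_le_norm _ _)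
    have e3 : ‖H x‖ * ‖g x‖ ≤ lam / 2 * ‖g x‖ ^ 2 + (2 * lam)⁻¹ * ‖H x‖ ^ 2 := by
      have : lam / 2 * ‖g x‖ ^ 2 + (2 * lam)⁻¹ * ‖H x‖ ^ 2 - ‖H x‖ * ‖g x‖
          = (2 * lam)⁻¹ * (lam * ‖g x‖ - ‖H x‖) ^ 2 := by
        field_simp
        ring
      have : 0 ≤ (2 * lam)⁻¹ * (lam * ‖g x‖ - ‖H x‖) ^ 2 := by positivity
      linarith
    linarith
  rw [integral_sub (hgsq.const_mul _) (hHsq.const_mul _), integral_const_mul,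
    integral_const_mul] at hint
  have hfin : ∫ x, ‖g x‖ ^ 2 ∂μ ≤ (lam⁻¹) ^ 2 * ∫ x, ‖H x‖ ^ 2 ∂μ := by
    have h3 : lam / 2 * ∫ x, ‖g x‖ ^ 2 ∂μ ≤ (2 * lam)⁻¹ * ∫ x, ‖H x‖ ^ 2 ∂μ := by linarith
    calc ∫ x, ‖g x‖ ^ 2 ∂μ = 2 / lam * (lam / 2 * ∫ x, ‖g x‖ ^ 2 ∂μ) := by field_simp
      _ ≤ 2 / lam * ((2 * lam)⁻¹ * ∫ x, ‖H x‖ ^ 2 ∂μ) := by gcongr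
      _ = _ := by field_simp
  rw [hg2.eLpNorm_eq_integral_rpow_norm two_ne_zero ENNReal.ofNat_ne_top,
    hH.eLpNorm_eq_integral_rpow_norm two_ne_zero ENNReal.ofNat_ne_top,
    ← ENNReal.ofReal_mul (by positivity)]
  refine ENNReal.ofReal_le_ofReal ?_
  simp only [ENNReal.toReal_ofNat, Real.rpow_ofNat]
  rw [← one_div, ← Real.sqrt_eq_rpow, ← Real.sqrt_eq_rpow]
  refine (Real.sqrt_le_sqrt hfin).trans ?_
  rw [Real.sqrt_mul (by positivity), Real.sqrt_sq (by positivity)]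

end WeakMax

theorem proposition3p5 {d : ℕ} (U : Set (WeakMax.Eucl d))
    (H : WeakMax.Eucl d → WeakMax.Eucl d)
    (A : WeakMax.Eucl d → Matrix (Fin d) (Fin d) ℝ)
    (hT1 : WeakMax.ConditionT1 U H A)
    (u : WeakMax.Eucl d → ℝ) (hu : WeakMax.MemH10 U u)
    (hB : ∀ φ : WeakMax.Eucl d → ℝ, WeakMax.MemH10 U φ →
      (∀ᵐ x ∂(volume.restrict U), 0 ≤ φ x) → WeakMax.bilin U H A u φ ≤ 0) :
    ∀ᵐ x ∂(volume.restrict U), u x ≤ 0 := by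
  have hU := hT1.isOpen
  obtain ⟨M, lam, -, hlam, hell⟩ := hT1.elliptic
  have hfin : IsFiniteMeasure (volume.restrict U) :=
    ⟨by simpa using hT1.isBounded.measure_lt_top⟩
  have hH : MemLp H 2 (volume.restrict U) :=
    hT1.memLp_drift.mono_exponent (by exact_mod_cast (show 2 ≤ d by have := hT1.three_le; omega))
  obtain ⟨C, hC⟩ := WeakMax.exists_poincare hT1.three_le hU hT1.isBounded
  -- the bound on the `L²` norms of the primitives, independent of the regularization `w`
  set D : ℝ≥0∞ := C * (ENNReal.ofReal lam⁻¹ * eLpNorm H 2 (volume.restrict U)) with hD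
  have hDtop : D ^ (2 : ℝ≥0∞).toReal ≠ ⊤ :=
    ENNReal.rpow_ne_top_of_nonneg (by simp) (ENNReal.mul_ne_top ENNReal.coe_ne_top
      (ENNReal.mul_ne_top ENNReal.ofReal_ne_top hH.eLpNorm_ne_top))
  have hδ : ∀ δ : ℝ, 0 < δ → ∀ᵐ x ∂(volume.restrict U), u x < δ := by
    intro δ hδ
    rw [ae_iff]
    by_contra hne
    obtain ⟨n, hn0, hn⟩ := ENNReal.exists_nat_pos_mul_gt hne hDtop
    obtain ⟨w, hw, hw0, hneg, ⟨K, hK⟩, hsw, hlarge⟩ :=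
      WeakMax.exists_smooth_regularized_inv hδ (Nat.cast_nonneg (α := ℝ) n)
    have hderiv : deriv (fun s => ∫ t in (0 : ℝ)..s, w t) = w :=
      funext fun s => (WeakMax.hasDerivAt_primitive hw.continuous s).deriv
    obtain ⟨hG, hGG⟩ := hu.comp hU (WeakMax.contDiff_primitive hw) (by simp) (K := K) (fun t => by
      rw [hderiv, abs_of_nonneg (hw0 t)]
      exact hK t)
    rw [hderiv] at hGG
    have hle : eLpNorm (fun x => ∫ t in (0 : ℝ)..(u x), w t) 2 (volume.restrict U) ≤ D := by
      refine (hC _ hG).trans ?_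
      rw [eLpNorm_congr_ae (hGG.weakGrad_ae_eq hU), hD]
      gcongr
      exact WeakMax.eLpNorm_smul_weakGrad_le hU hH hT1.aemeasurable_coeff hlam hell hu hB hw hw0
        hneg hK hsw
    have hmarkov := mul_meas_ge_le_pow_eLpNorm' (volume.restrict U) (p := 2) two_ne_zero
      ENNReal.ofNat_ne_top hG.1.1.aestronglyMeasurable (n : ℝ≥0∞)
    refine absurd hn (not_lt.2 ?_)
    calc (n : ℝ≥0∞) * (volume.restrict U) {x | ¬ u x < δ}
        ≤ (n : ℝ≥0∞) ^ (2 : ℝ≥0∞).toReal *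
          (volume.restrict U) {x | (n : ℝ≥0∞) ≤ ‖∫ t in (0 : ℝ)..(u x), w t‖ₑ} := by
          gcongr
          · have h1 : (1 : ℝ≥0∞) ≤ n := by exact_mod_cast hn0
            simpa using ENNReal.rpow_le_rpow_of_exponent_le h1 (show (1 : ℝ) ≤ 2 by norm_num)
          · intro hx
            rw [← ENNReal.ofReal_natCast, ← ofReal_norm]
            exact ENNReal.ofReal_le_ofReal
              ((hlarge _ (not_lt.1 hx)).trans (Real.le_norm_self _))
      _ ≤ _ := hmarkov
      _ ≤ _ := by gcongr
  filter_upwards [ae_all_iff.2 fun n : ℕ => hδ (1 / ((n : ℝ) + 1)) Nat.one_div_pos_of_nat] with x hx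
  refine le_of_forall_pos_lt_add fun ε hε => ?_
  obtain ⟨n, hn⟩ := exists_nat_one_div_lt hε
  linarith [hx n]
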